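/- Let $R_0,C_0,\alpha,R_1,R_a,C_1>0$, put $a=\frac{R_1+R_a}{R_1R_aC_1}$, $b=\frac{1}{R_aC_1}$, and let $\varphi:\mathbb R\to\mathbb R$ be a continuously differentiable odd function with $\varphi'\ge 0$ such that for every $k>0$ there is $r>0$ with $y\varphi(y)-ky^2>0$ for all $|y|>r$. Consider the op-amp in positive feedback with the $RC$ network, i.e. the system with state $(x,z)\in\mathbb R^2$, input $V_r$ and output $V_0=x$, $$\dot x=-\tfrac{1}{R_0C_0}x-\tfrac1{C_0}\varphi(x)+\tfrac{\alpha}{C_0}(z+V_r),\qquad \dot z=-az+bx .$$ A system $\dot\xi=f(\xi)+Bu$, $y=C\xi$ with $\xi\in\mathbb R^n$ is called strictly $p$-passive from $u$ to $y$ with rate $\lambda\ge0$ if there are a constant symmetric matrix $P$ with $p$ negative, no zero and $n-p$ positive eigenvalues and an $\varepsilon>0$ such that, for all $\xi,\delta\xi,\delta u$, with $\dot{\delta \xi}=\partial f(\xi)\,\delta\xi+B\,\delta u$ and $\delta y=C\,\delta\xi$, $$\begin{bmatrix}\dot{\delta\xi}\\ \delta\xi\end{bmatrix}^{\top}\begin{bmatrix}0&P\\P&2\lambda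 P+\varepsilon I\end{bmatrix}\begin{bmatrix}\dot{\delta\xi}\\ \delta\xi\end{bmatrix}\le\begin{bmatrix}\delta y\\ \delta u\end{bmatrix}^{\top}\begin{bmatrix}0&I\\I&0\end{bmatrix}\begin{bmatrix}\delta y\\ \delta u\end{bmatrix}.$$ Suppose that $\frac1{R_0C_0}>a$. Then: 1. The system is strictly $1$-passive from $V_r$ to $V_0$ with every rate $\lambda\in\left(a,\frac1{R_0C_0}\right)$. 2. For every constant input $V_r\in\mathbb R$, every initial condition admits a trajectory defined on $[0,\infty)$, and every trajectory on $[0,\infty)$ converges, as $t\to\infty$, to a fixed point. 3. Let $V_r=0$ and suppose that $\varphi'(0)<-\frac1{R_0}+\frac{\alpha R_1}{R_1+R_a}$. Then the origin is a saddle (the linearization there has one negative and one positive real eigenvalue), and there are at least two further fixed points $\pm e\neq 0$. If moreover $\varphi$ is stiffening, in the sense that $\varphi'$ is nondecreasing on $[0,\infty)$ (as for $\varphi(y)=\eta\sinh(\beta y)$ with $\eta,\beta>0$), then the circuit is bistable: it has exactly three fixed points, two of which are stable nodes (the linearization has two negative real eigenvalues) and one of which is a saddle. -/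

import Mathlib

open Set Filter Topology

noncomputable section

namespace OpAmp

/-- An open system `ẋ = f x + B u`, `y = C x` with `n` states, `m` inputs and `q` outputs. -/
structure OpenSystem (n m q : ℕ) where
  f : (Fin n → ℝ) → (Fin n → ℝ)
  B : Matrix (Fin n) (Fin m) ℝ
  C : Matrix (Fin q) (Fin n) ℝ

/-- The Jacobian matrix of `f` at `x`. -/
def jacobian {n : ℕ} (f : (Fin n → ℝ) → (Fin n → ℝ)) (x : Fin n → ℝ) :
    Matrix (Fin n) (Fin n) ℝ :=
  LinearMap.toMatrix' (fderiv ℝ f x).toLinearMap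

/-- The numbers of negative, zero and positive eigenvalues (with multiplicity) are `p`, `k`, `q`.
For a symmetric matrix all eigenvalues are real. -/
def HasInertia {n : ℕ} (P : Matrix (Fin n) (Fin n) ℝ) (p k q : ℕ) : Prop :=
  P.charpoly.roots.countP (fun μ => μ < 0) = p ∧
  P.charpoly.roots.countP (fun μ => μ = 0) = k ∧
  P.charpoly.roots.countP (fun μ => 0 < μ) = q

/-- The value at the stacked vector `(v, w)` of the quadratic form of a `2 × 2` block matrix. -/
def blockForm {k l : ℕ} (M : Matrix (Fin k ⊕ Fin l) (Fin k ⊕ Fin l) ℝ)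
    (v : Fin k → ℝ) (w : Fin l → ℝ) : ℝ :=
  dotProduct (Sum.elim v w) (M.mulVec (Sum.elim v w))

namespace OpenSystem

/-- The vector field of the system under the constant input `u`. -/
def field {n m q : ℕ} (S : OpenSystem n m q) (u : Fin m → ℝ) (x : Fin n → ℝ) : Fin n → ℝ :=
  S.f x + S.B.mulVec u

/-- Strict `p`-passivity with rate `lam`, from the input to the output: the prolonged system
`δẋ = ∂f(x) δx + B δu`, `δy = C δx` satisfies the differential dissipation inequality with a
constant symmetric matrix `P` of inertia `(p, 0, n - p)` and some `ε > 0`. -/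
def IsStrictlyPassive {n m : ℕ} (S : OpenSystem n m m) (p : ℕ) (lam : ℝ) : Prop :=
  0 ≤ lam ∧ Differentiable ℝ S.f ∧
  ∃ (P : Matrix (Fin n) (Fin n) ℝ) (ε : ℝ), P.IsSymm ∧ HasInertia P p 0 (n - p) ∧ 0 < ε ∧
    ∀ (x δx : Fin n → ℝ) (δu : Fin m → ℝ),
      blockForm (Matrix.fromBlocks 0 P P ((2 * lam) • P + ε • (1 : Matrix (Fin n) (Fin n) ℝ)))
          ((jacobian S.f x).mulVec δx + S.B.mulVec δu) δx
        ≤ blockForm (Matrix.fromBlocks 0 1 1 0) (S.C.mulVec δx) δu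

end OpenSystem

/-- A forward trajectory (on `[0, ∞)`) of the autonomous vector field `F`. -/
def IsTrajectory {n : ℕ} (F : (Fin n → ℝ) → (Fin n → ℝ)) (γ : ℝ → (Fin n → ℝ)) : Prop :=
  IsIntegralCurveOn γ (fun _ => F) (Ici 0)

/-- A stable node of a planar vector field: an equilibrium whose linearization has two negative
real eigenvalues (counted with multiplicity). -/
def IsStableNode (F : (Fin 2 → ℝ) → (Fin 2 → ℝ)) (e : Fin 2 → ℝ) : Prop :=
  F e = 0 ∧ DifferentiableAt ℝ F e ∧ ∃ μ₁ μ₂ : ℝ, μ₁ < 0 ∧ μ₂ < 0 ∧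
    (jacobian F e).charpoly.roots = {μ₁, μ₂}

/-- A saddle of a planar vector field: an equilibrium whose linearization has one negative and
one positive real eigenvalue. -/
def IsSaddle (F : (Fin 2 → ℝ) → (Fin 2 → ℝ)) (e : Fin 2 → ℝ) : Prop :=
  F e = 0 ∧ DifferentiableAt ℝ F e ∧ ∃ μ₁ μ₂ : ℝ, μ₁ < 0 ∧ 0 < μ₂ ∧
    (jacobian F e).charpoly.roots = {μ₁, μ₂}

/-- Exactly three equilibria: two stable nodes and a saddle. -/
def IsBistable (F : (Fin 2 → ℝ) → (Fin 2 → ℝ)) : Prop :=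
  ∃ e₁ e₂ s : Fin 2 → ℝ, e₁ ≠ e₂ ∧ e₁ ≠ s ∧ e₂ ≠ s ∧ {e | F e = 0} = {e₁, e₂, s} ∧
    IsStableNode F e₁ ∧ IsStableNode F e₂ ∧ IsSaddle F s

/-- The standing assumption on the static nonlinearity. -/
structure IsSaturation (φ : ℝ → ℝ) : Prop where
  contDiff : ContDiff ℝ 1 φ
  odd : ∀ y, φ (-y) = -φ y
  deriv_nonneg : ∀ y, 0 ≤ deriv φ y
  dominates : ∀ k > 0, ∃ r > 0, ∀ y, r < |y| → 0 < y * φ y - k * y ^ 2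

/-- The nonlinearity is stiffening: its slope does not decrease as the amplitude grows. (As `φ` is
odd, it suffices to say so for nonnegative arguments.) -/
def IsStiffening (φ : ℝ → ℝ) : Prop :=
  MonotoneOn (deriv φ) (Ici 0)

/-- Component values of the op-amp (`R₀, C₀, α`) and of the `RC` network (`R₁, Ra, C₁`). -/
structure Params where
  R₀ : ℝ
  C₀ : ℝ
  α : ℝ
  R₁ : ℝ
  Ra : ℝ
  C₁ : ℝ
  R₀_pos : 0 < R₀
  C₀_pos : 0 < C₀
  α_pos : 0 < α
  R₁_pos : 0 < R₁
  Ra_pos : 0 < Ra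
  C₁_pos : 0 < C₁

namespace Params

/-- The pole parameter of the `RC` network. -/
def a (c : Params) : ℝ := (c.R₁ + c.Ra) / (c.R₁ * c.Ra * c.C₁)

/-- The input gain of the `RC` network. -/
def b (c : Params) : ℝ := 1 / (c.Ra * c.C₁)

/-- The op-amp: `ẋ = -x / (R₀ C₀) - φ x / C₀ + (α / C₀) V_E`, with output `V₀ = x`. -/
def opAmpRate (c : Params) (φ : ℝ → ℝ) (x VE : ℝ) : ℝ :=
  -(1 / (c.R₀ * c.C₀)) * x - 1 / c.C₀ * φ x + c.α / c.C₀ * VE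

/-- The `RC` network: `ż = -a z + b u`, with output `z`. -/
def networkRate (c : Params) (z u : ℝ) : ℝ := -c.a * z + c.b * u

/-- The op-amp in positive feedback with the `RC` network, `V_E = z + V_r` and `u = V₀`, as an open
system with state `(x, z)`, input `V_r` and output `V₀ = x`. -/
def closedLoop (c : Params) (φ : ℝ → ℝ) : OpenSystem 2 1 1 where
  f := fun s => ![c.opAmpRate φ (s 0) (s 1), c.networkRate (s 1) (s 0)]
  B := !![c.α / c.C₀; 0]
  C := !![1, 0]

theorem closedLoop_field (c : Params) (φ : ℝ → ℝ) (Vr : ℝ) (s : Fin 2 → ℝ) :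
    (c.closedLoop φ).field ![Vr] s =
      ![c.opAmpRate φ (s 0) (s 1 + Vr), c.networkRate (s 1) (s 0)] := by
  ext i
  fin_cases i
  · simp [OpenSystem.field, closedLoop, opAmpRate]
    ring
  · simp [OpenSystem.field, closedLoop]

end Params

end OpAmp

end


/-!
The network state is weighted negatively against the op-amp state in the storage, with weights that
make the two coupling terms cancel, so that passivity reduces to `a < λ < 1 / (R₀ C₀)` and the
monotonicity of `φ`.

For convergence, the couplings `α / C₀` and `b` are nonnegative, so the circuit is a planar
cooperative system. The velocity along a trajectory solves the linear variational equation, and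
after removing the diagonal by integrating factors the product of its two components is
nondecreasing; hence each component eventually has a constant sign, and a bounded trajectory
converges coordinatewise. Boundedness, and with it global existence, holds because the
superlinear `φ` makes the field point into every large disc.

The equilibria are the intersections of the graph of `φ` with the load line, and the determinant of
the linearization has the sign of the difference of their slopes. A stiffening `φ` is convex on
`[0, ∞)`, so past the origin it crosses the line only once, from below.
-/

open scoped Manifold

namespace OpAmp

section Asymptotics

/-- A real function that is nonnegative from some time on, or nonpositive from some time on. -/
def HasEventualSign (u : ℝ → ℝ) : Prop :=
  (∀ᶠ t in atTop, 0 ≤ u t) ∨ ∀ᶠ t in atTop, u t ≤ 0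

theorem eventually_ne_or_eventually_eq_of_monotoneOn_Ici {α β : Type*} [LinearOrder α]
    [PartialOrder β] {f : α → β} {a : α} (hf : MonotoneOn f (Ici a)) (c : β) :
    (∀ᶠ t in atTop, f t ≠ c) ∨ ∀ᶠ t in atTop, f t = c := by
  have : Nonempty α := ⟨a⟩
  by_contra! ⟨heq, hne⟩
  simp only [frequently_atTop] at heq hne
  obtain ⟨r, har, hr⟩ := heq a
  obtain ⟨s, hrs, hs⟩ := hne r
  obtain ⟨t, hst, ht⟩ := heq s
  have has : a ≤ s := har.trans hrs
  exact hs (le_antisymm ((hf has (has.trans hst) hst).trans_eq ht)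
    (hr.symm.trans_le (hf har has hrs)))

theorem hasEventualSign_of_monotoneOn_Ici {u : ℝ → ℝ} {a : ℝ} (hu : MonotoneOn u (Ici a)) :
    HasEventualSign u := by
  by_cases! h : ∃ s, a ≤ s ∧ 0 ≤ u s
  · obtain ⟨s, has, hs⟩ := h
    refine .inl ?_
    filter_upwards [eventually_ge_atTop s] with t hst
    exact hs.trans (hu has (has.trans hst) hst)
  · refine .inr ?_
    filter_upwards [eventually_ge_atTop a] with t hat
    exact (h t hat).le

theorem hasEventualSign_of_eventually_ne_zero {u : ℝ → ℝ}
    (hcont : ∀ᶠ t in atTop, ContinuousAt u t) (hne : ∀ᶠ t in atTop, u t ≠ 0) :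
    HasEventualSign u := by
  obtain ⟨a, ha⟩ := eventually_atTop.1 (hcont.and hne)
  have hu : ContinuousOn u (Ici a) := fun t ht => (ha t ht).1.continuousWithinAt
  by_contra! h
  simp only [HasEventualSign, not_or, not_eventually, not_le, frequently_atTop] at h
  obtain ⟨⟨s, hs, hus⟩, t, ht, hut⟩ := h.imp (· a) (· a)
  obtain ⟨r, hr, hr0⟩ := isPreconnected_Ici.intermediate_value hs ht hu ⟨hus.le, hut.le⟩
  exact (ha r hr).2 hr0

theorem exists_monotoneOn_Ici_of_eventually_deriv_nonneg {f f' : ℝ → ℝ}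
    (hf : ∀ᶠ t in atTop, HasDerivAt f (f' t) t) (hf' : ∀ᶠ t in atTop, 0 ≤ f' t) :
    ∃ a, MonotoneOn f (Ici a) := by
  obtain ⟨a, ha⟩ := eventually_atTop.1 (hf.and hf')
  refine ⟨a, monotoneOn_of_hasDerivWithinAt_nonneg (f' := f') (convex_Ici a)
    (fun t ht => (ha t ht).1.continuousAt.continuousWithinAt) ?_ ?_⟩
  · exact fun t ht => (ha t (interior_subset ht)).1.hasDerivWithinAt
  · exact fun t ht => (ha t (interior_subset ht)).2

theorem exists_tendsto_of_hasEventualSign_deriv {f f' : ℝ → ℝ} {M : ℝ}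
    (hf : ∀ᶠ t in atTop, HasDerivAt f (f' t) t) (hsign : HasEventualSign f')
    (hM : ∀ᶠ t in atTop, |f t| ≤ M) : ∃ l, Tendsto f atTop (𝓝 l) := by
  wlog hf' : ∀ᶠ t in atTop, 0 ≤ f' t generalizing f f'
  · have hneg : ∀ᶠ t in atTop, 0 ≤ -f' t :=
      (hsign.resolve_left hf').mono fun t => neg_nonneg.2
    obtain ⟨l, hl⟩ := this (hf.mono fun t => HasDerivAt.fun_neg) (.inl hneg)
      (by simpa only [abs_neg] using hM) hneg
    exact ⟨-l, by simpa using hl.neg⟩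
  obtain ⟨a, ha⟩ := exists_monotoneOn_Ici_of_eventually_deriv_nonneg hf hf'
  obtain ⟨b, hb⟩ := eventually_atTop.1 hM
  set c := max a b
  have hmono : Monotone fun t => f (max t c) := fun s t hst =>
    ha ((le_max_left a b).trans (le_max_right s c)) ((le_max_left a b).trans (le_max_right t c))
      (max_le_max_right c hst)
  have hbdd : BddAbove (range fun t => f (max t c)) := by
    refine ⟨M, forall_mem_range.2 fun t => (le_abs_self _).trans (hb _ ?_)⟩
    exact (le_max_right a b).trans (le_max_right t c)
  refine ⟨_, (tendsto_atTop_ciSup hmono hbdd).congr' ?_⟩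
  filter_upwards [eventually_ge_atTop c] with t ht
  rw [max_eq_left ht]

theorem eq_zero_of_tendsto_of_tendsto_deriv {E : Type*} [NormedAddCommGroup E] [NormedSpace ℝ E]
    {f f' : ℝ → E} {l m : E} (hf : ∀ᶠ t in atTop, HasDerivAt f (f' t) t)
    (hl : Tendsto f atTop (𝓝 l)) (hm : Tendsto f' atTop (𝓝 m)) : m = 0 := by
  have hincr : Tendsto (fun t => ‖f (t + 1) - f t - m‖) atTop (𝓝 ‖l - l - m‖) :=
    (((hl.comp (tendsto_atTop_add_const_right _ 1 tendsto_id)).sub hl).sub_const m).norm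
  rw [sub_self, zero_sub, norm_neg] at hincr
  refine norm_le_zero_iff.1 (le_of_forall_pos_le_add fun ε hε => ?_)
  rw [zero_add]
  refine le_of_tendsto hincr ?_
  have hclose : ∀ᶠ t in atTop, ‖f' t - m‖ ≤ ε := by
    filter_upwards [Metric.tendsto_nhds.1 hm ε hε] with t ht
    exact (dist_eq_norm (f' t) m ▸ ht).le
  filter_upwards [eventually_forall_ge_atTop.2 (hf.and hclose)] with t ht
  have hmean := (convex_Ici t).norm_image_sub_le_of_norm_hasDerivWithin_le
    (f := fun s => f s - s • m) (f' := fun s => f' s - m) (C := ε) (x := t) (y := t + 1)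
    (fun s hs => ((ht s hs).1.sub (by simpa using (hasDerivAt_id s).smul_const m)).hasDerivWithinAt)
    (fun s hs => (ht s hs).2) self_mem_Ici
    (mem_Ici.2 (le_add_of_nonneg_right zero_le_one))
  simpa [add_smul, sub_add_eq_sub_sub, sub_right_comm] using hmean

theorem exists_eventually_hasDerivAt_of_eventually_continuousAt {p : ℝ → ℝ}
    (hp : ∀ᶠ t in atTop, ContinuousAt p t) : ∃ P, ∀ᶠ t in atTop, HasDerivAt P (p t) t := by
  obtain ⟨a, ha⟩ := eventually_atTop.1 hp
  refine ⟨fun t => ∫ s in a..t, p s, ?_⟩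
  filter_upwards [eventually_gt_atTop a] with t hat
  refine intervalIntegral.integral_hasDerivAt_right ?_ ?_ (ha t hat.le)
  · refine ContinuousOn.intervalIntegrable fun s hs => (ha s ?_).continuousWithinAt
    exact (uIcc_of_le hat.le ▸ hs).1
  · exact ContinuousAt.stronglyMeasurableAtFilter isOpen_Ioi (fun s hs => ha s (le_of_lt hs)) t hat

end Asymptotics

section LinearCooperative

-- The product `u * v` is nondecreasing, so it is eventually nonzero or eventually constant zero.
theorem hasEventualSign_of_hasDerivAt_mul {u v q r : ℝ → ℝ}
    (hu : ∀ᶠ t in atTop, HasDerivAt u (q t * v t) t)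
    (hv : ∀ᶠ t in atTop, HasDerivAt v (r t * u t) t)
    (hq : ∀ᶠ t in atTop, 0 ≤ q t) (hr : ∀ᶠ t in atTop, 0 ≤ r t) : HasEventualSign u := by
  have hdprod : ∀ᶠ t in atTop, HasDerivAt (u * v) (q t * v t ^ 2 + r t * u t ^ 2) t := by
    filter_upwards [hu, hv] with t hut hvt
    exact (hut.mul hvt).congr_deriv (by ring)
  have hnonneg : ∀ᶠ t in atTop, 0 ≤ q t * v t ^ 2 ∧ 0 ≤ r t * u t ^ 2 := by
    filter_upwards [hq, hr] with t hqt hrt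
    exact ⟨by positivity, by positivity⟩
  obtain ⟨a, hmono⟩ := exists_monotoneOn_Ici_of_eventually_deriv_nonneg hdprod
    (hnonneg.mono fun t ht => add_nonneg ht.1 ht.2)
  rcases eventually_ne_or_eventually_eq_of_monotoneOn_Ici hmono 0 with hne | hzero
  · exact hasEventualSign_of_eventually_ne_zero (hu.mono fun t ht => ht.continuousAt)
      (hne.mono fun t => left_ne_zero_of_mul)
  · obtain ⟨b, hb⟩ := eventually_atTop.1 hzero
    have hstationary : ∀ᶠ t in atTop, 0 ≤ q t * v t := by
      filter_upwards [hdprod, hnonneg, eventually_gt_atTop b] with t hdt hnt hbt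
      have hloc : u * v =ᶠ[𝓝 t] fun _ => 0 := by
        filter_upwards [Ioi_mem_nhds hbt] with s hs using hb s (le_of_lt hs)
      have hsum := hdt.unique ((hasDerivAt_const t (0 : ℝ)).congr_of_eventuallyEq hloc)
      have hqv : q t * v t ^ 2 = 0 := ((add_eq_zero_iff_of_nonneg hnt.1 hnt.2).1 hsum).1
      exact (by simpa using hqv : q t * v t = 0).ge
    obtain ⟨c, hc⟩ := exists_monotoneOn_Ici_of_eventually_deriv_nonneg hu hstationary
    exact hasEventualSign_of_monotoneOn_Ici hc

theorem hasEventualSign_of_linear_cooperative {A : ℝ → Matrix (Fin 2) (Fin 2) ℝ}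
    {w : ℝ → Fin 2 → ℝ} (hcont : ∀ i, ∀ᶠ t in atTop, ContinuousAt (fun s => A s i i) t)
    (hoff : ∀ i j, i ≠ j → ∀ᶠ t in atTop, 0 ≤ A t i j)
    (hw : ∀ᶠ t in atTop, HasDerivAt w ((A t).mulVec (w t)) t) (i : Fin 2) :
    HasEventualSign fun t => w t i := by
  choose P hP using fun i => exists_eventually_hasDerivAt_of_eventually_continuousAt (hcont i)
  -- The integrating factors `exp (-P i)` remove the diagonal of `A`.
  have hscaled : ∀ i j, i ≠ j → ∀ᶠ t in atTop, HasDerivAt (fun t => Real.exp (-P i t) * w t i)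
      (Real.exp (-P i t) * A t i j * Real.exp (P j t) * (Real.exp (-P j t) * w t j)) t := by
    intro i j hij
    filter_upwards [hP i, hw] with t hPt hwt
    refine (hPt.neg.exp.mul (hasDerivAt_pi.1 hwt i)).congr_deriv ?_
    have hmulVec : (A t).mulVec (w t) i = A t i i * w t i + A t i j * w t j := by
      fin_cases i <;> fin_cases j <;>
        simp_all [Matrix.mulVec, dotProduct, Fin.sum_univ_two, add_comm]
    have hexp : Real.exp (P j t) * Real.exp (-P j t) = 1 := by rw [← Real.exp_add]; simp
    rw [hmulVec, Pi.neg_apply]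
    linear_combination -Real.exp (-P i t) * A t i j * w t j * hexp
  have hcoeff : ∀ i j, i ≠ j → ∀ᶠ t in atTop,
      0 ≤ Real.exp (-P i t) * A t i j * Real.exp (P j t) := by
    intro i j hij
    filter_upwards [hoff i j hij] with t ht
    positivity
  obtain ⟨j, hij⟩ := exists_ne i
  have hsign := hasEventualSign_of_hasDerivAt_mul (hscaled i j hij.symm) (hscaled j i hij)
    (hcoeff i j hij.symm) (hcoeff j i hij)
  exact hsign.imp
    (fun h => h.mono fun t => (mul_nonneg_iff_of_pos_left (Real.exp_pos _)).1)
    (fun h => h.mono fun t => (mul_nonpos_iff_pos_imp_nonpos.1 · |>.1 (Real.exp_pos _)))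

end LinearCooperative

section PlanarCooperative

theorem jacobian_mulVec {n : ℕ} (F : (Fin n → ℝ) → (Fin n → ℝ)) (x v : Fin n → ℝ) :
    (jacobian F x).mulVec v = fderiv ℝ F x v :=
  LinearMap.toMatrix'_mulVec _ v

theorem continuous_jacobian {n : ℕ} {F : (Fin n → ℝ) → (Fin n → ℝ)} (hF : ContDiff ℝ 1 F) :
    Continuous (jacobian F) := by
  refine continuous_matrix fun i j => ?_
  have hentry : ∀ x, jacobian F x i j = fderiv ℝ F x (Pi.single j 1) i := by
    intro x
    rw [← jacobian_mulVec, Matrix.mulVec_single_one, Matrix.col_apply]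
  simp only [hentry]
  have := hF.continuous_fderiv one_ne_zero
  fun_prop

theorem IsTrajectory.eventually_hasDerivAt {n : ℕ} {F : (Fin n → ℝ) → (Fin n → ℝ)}
    {γ : ℝ → Fin n → ℝ} (hγ : IsTrajectory F γ) :
    ∀ᶠ t in atTop, HasDerivAt γ (F (γ t)) t := by
  filter_upwards [eventually_gt_atTop 0] with t ht
  exact (hγ t ht.le).hasDerivAt (Ici_mem_nhds ht)

theorem IsTrajectory.eventually_hasDerivAt_field {n : ℕ} {F : (Fin n → ℝ) → (Fin n → ℝ)}
    {γ : ℝ → Fin n → ℝ} (hγ : IsTrajectory F γ) (hF : Differentiable ℝ F) :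
    ∀ᶠ t in atTop, HasDerivAt (fun s => F (γ s)) ((jacobian F (γ t)).mulVec (F (γ t))) t := by
  filter_upwards [hγ.eventually_hasDerivAt] with t ht
  rw [jacobian_mulVec]
  exact (hF (γ t)).hasFDerivAt.comp_hasDerivAt t ht

theorem IsTrajectory.eq_zero_of_tendsto {n : ℕ} {F : (Fin n → ℝ) → (Fin n → ℝ)}
    {γ : ℝ → Fin n → ℝ} {e : Fin n → ℝ} (hγ : IsTrajectory F γ) (hF : ContinuousAt F e)
    (he : Tendsto γ atTop (𝓝 e)) : F e = 0 :=
  eq_zero_of_tendsto_of_tendsto_deriv hγ.eventually_hasDerivAt he (hF.tendsto.comp he)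

/-- A cooperative vector field: every coordinate is driven upwards by the others, in the sense that
the off-diagonal entries of the Jacobian matrices are nonnegative. -/
def IsCooperative {n : ℕ} (F : (Fin n → ℝ) → (Fin n → ℝ)) : Prop :=
  ∀ x i j, i ≠ j → 0 ≤ jacobian F x i j

theorem IsCooperative.exists_tendsto {F : (Fin 2 → ℝ) → (Fin 2 → ℝ)} (hcoop : IsCooperative F)
    (hF : ContDiff ℝ 1 F) {γ : ℝ → Fin 2 → ℝ} (hγ : IsTrajectory F γ)
    (hbdd : Bornology.IsBounded (γ '' Ici 0)) : ∃ e, F e = 0 ∧ Tendsto γ atTop (𝓝 e) := by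
  -- The velocity `F ∘ γ` solves the variational equation, which is linear and cooperative.
  have hsign : ∀ i, HasEventualSign fun t => F (γ t) i :=
    hasEventualSign_of_linear_cooperative
      (fun i => hγ.eventually_hasDerivAt.mono fun t ht =>
        ((continuous_jacobian hF).matrix_elem i i).continuousAt.comp ht.continuousAt)
      (fun i j hij => .of_forall fun t => hcoop (γ t) i j hij)
      (hγ.eventually_hasDerivAt_field (hF.differentiable one_ne_zero))
  obtain ⟨M, hM⟩ := isBounded_iff_forall_norm_le.1 hbdd
  have hlim : ∀ i, ∃ l, Tendsto (fun t => γ t i) atTop (𝓝 l) := fun i =>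
    exists_tendsto_of_hasEventualSign_deriv
      (hγ.eventually_hasDerivAt.mono fun t ht => hasDerivAt_pi.1 ht i) (hsign i)
      ((eventually_ge_atTop 0).mono fun t ht =>
        (norm_le_pi_norm (γ t) i).trans (hM _ (mem_image_of_mem γ ht)))
  choose e he using hlim
  have hγe : Tendsto γ atTop (𝓝 e) := tendsto_pi_nhds.2 he
  exact ⟨e, hγ.eq_zero_of_tendsto hF.continuous.continuousAt hγe, hγe⟩

end PlanarCooperative

section Dissipative

theorem exists_isIntegralCurve_of_hasCompactSupport {E : Type*} [NormedAddCommGroup E]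
    [NormedSpace ℝ E] [CompleteSpace E] {G : E → E} (hG : ContDiff ℝ 1 G)
    (hsupp : HasCompactSupport G) (x₀ : E) :
    ∃ γ : ℝ → E, γ 0 = x₀ ∧ IsIntegralCurve γ fun _ => G := by
  obtain ⟨K, hK⟩ := ContDiff.lipschitzWith_of_hasCompactSupport hsupp hG one_ne_zero
  obtain ⟨L, hL⟩ := hsupp.exists_bound_of_continuous hG.continuous
  have hlocal : ∀ x, ∃ γ : ℝ → E, γ 0 = x ∧ IsMIntegralCurveOn (I := 𝓘(ℝ, E)) γ G (Ioo (-1) 1) := by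
    intro x
    have hPL : IsPicardLindelof (fun _ => G) (tmin := -1) (tmax := 1) ⟨0, by simp⟩ x
        L.toNNReal 0 L.toNNReal K :=
      .of_time_independent (fun y _ => (hL y).trans (Real.le_coe_toNNReal L))
        hK.lipschitzOnWith (by simp)
    obtain ⟨γ, hγ₀, hγ⟩ := hPL.exists_eq_forall_mem_Icc_hasDerivWithinAt₀
    refine ⟨γ, hγ₀, fun t ht => ?_⟩
    exact ((hγ t (Ioo_subset_Icc_self ht)).mono
      Ioo_subset_Icc_self).hasFDerivWithinAt.hasMFDerivWithinAt
  obtain ⟨γ, hγ₀, hγ⟩ := exists_isMIntegralCurve_of_isMIntegralCurveOn (I := 𝓘(ℝ, E)) (v := G)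
    (contMDiff_vectorSpace_iff_contDiff.2 hG) zero_lt_one (fun x => by simpa using hlocal x) x₀
  exact ⟨γ, hγ₀, fun t => hasDerivAt_iff_hasFDerivAt.2 (hγ t).hasFDerivAt⟩

theorem IsTrajectory.dotProduct_self_le {n : ℕ} {F : (Fin n → ℝ) → (Fin n → ℝ)}
    {γ : ℝ → Fin n → ℝ} {R : ℝ} (hγ : IsTrajectory F γ)
    (hinward : ∀ x, x ⬝ᵥ x = R → x ⬝ᵥ F x < 0) (h₀ : γ 0 ⬝ᵥ γ 0 ≤ R) {t : ℝ} (ht : 0 ≤ t) :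
    γ t ⬝ᵥ γ t ≤ R := by
  have hderiv : ∀ s ∈ Ici (0 : ℝ),
      HasDerivWithinAt (fun s => γ s ⬝ᵥ γ s) (2 * (γ s ⬝ᵥ F (γ s))) (Ici 0) s := by
    intro s hs
    have hcoord := hasDerivWithinAt_pi.1 (hγ s hs)
    refine (HasDerivWithinAt.fun_sum fun i _ => (hcoord i).mul (hcoord i)).congr_deriv ?_
    rw [dotProduct, Finset.mul_sum]
    exact Finset.sum_congr rfl fun i _ => by ring
  refine image_le_of_deriv_right_lt_deriv_boundary' (a := 0) (b := t)
    (f := fun s => γ s ⬝ᵥ γ s) (B := fun _ => R) (B' := fun _ => 0)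
    (fun s hs => ((hderiv s hs.1).mono Icc_subset_Ici_self).continuousWithinAt)
    (fun s hs => (hderiv s hs.1).mono (Ici_subset_Ici.2 hs.1)) h₀ continuousOn_const
    (fun s _ => hasDerivWithinAt_const _ _ _) (fun s _ hs => ?_) ⟨ht, le_rfl⟩
  linarith [hinward (γ s) hs]

theorem norm_le_sqrt_dotProduct_self {ι : Type*} [Fintype ι] (x : ι → ℝ) :
    ‖x‖ ≤ √(x ⬝ᵥ x) := by
  refine (pi_norm_le_iff_of_nonneg (Real.sqrt_nonneg _)).2 fun i => Real.abs_le_sqrt ?_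
  rw [sq]
  exact Finset.single_le_sum (f := fun j => x j * x j) (fun j _ => mul_self_nonneg (x j))
    (Finset.mem_univ i)

/-- A vector field that points strictly into every sufficiently large Euclidean ball along its
boundary. The ball is written with the dot product, as the norm of `Fin n → ℝ` is the supremum
norm; `R` is the squared radius. -/
def IsEventuallyInward {n : ℕ} (F : (Fin n → ℝ) → (Fin n → ℝ)) : Prop :=
  ∀ᶠ R in atTop, ∀ x, x ⬝ᵥ x = R → x ⬝ᵥ F x < 0

theorem isEventuallyInward_of_le {n : ℕ} {F : (Fin n → ℝ) → (Fin n → ℝ)} {κ D : ℝ} (hκ : 0 < κ)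
    (hF : ∀ x, x ⬝ᵥ F x ≤ D - κ * (x ⬝ᵥ x)) : IsEventuallyInward F := by
  filter_upwards [eventually_gt_atTop (D / κ)] with R hR x hx
  have hDR : D < κ * R := (div_lt_iff₀' hκ).1 hR
  linarith [hx ▸ hF x]

theorem IsEventuallyInward.isBounded_image {n : ℕ} {F : (Fin n → ℝ) → (Fin n → ℝ)}
    {γ : ℝ → Fin n → ℝ} (hF : IsEventuallyInward F) (hγ : IsTrajectory F γ) :
    Bornology.IsBounded (γ '' Ici 0) := by
  obtain ⟨R, hinward, hR⟩ := (hF.and (eventually_ge_atTop (γ 0 ⬝ᵥ γ 0))).exists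
  refine isBounded_iff_forall_norm_le.2 ⟨√R, forall_mem_image.2 fun t ht => ?_⟩
  exact (norm_le_sqrt_dotProduct_self _).trans
    (Real.sqrt_le_sqrt (hγ.dotProduct_self_le hinward hR ht))

-- Cut the field off outside a trapping ball: the resulting flow is complete and stays in the ball.
theorem IsEventuallyInward.exists_isTrajectory {n : ℕ} {F : (Fin n → ℝ) → (Fin n → ℝ)}
    (hinward : IsEventuallyInward F) (hF : ContDiff ℝ 1 F) (x₀ : Fin n → ℝ) :
    ∃ γ, γ 0 = x₀ ∧ IsTrajectory F γ := by
  obtain ⟨R, hR, hx₀⟩ := (hinward.and (eventually_ge_atTop (x₀ ⬝ᵥ x₀))).exists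
  let χ : ContDiffBump (0 : Fin n → ℝ) := ⟨√R + 1, √R + 2, by positivity, by linarith⟩
  have hχ : ∀ x, x ⬝ᵥ x ≤ R → χ x • F x = F x := by
    intro x hx
    have hmem : x ∈ Metric.closedBall 0 χ.rIn := by
      refine mem_closedBall_zero_iff.2 ((norm_le_sqrt_dotProduct_self x).trans ?_)
      exact (Real.sqrt_le_sqrt hx).trans (le_add_of_nonneg_right zero_le_one)
    rw [χ.one_of_mem_closedBall hmem, one_smul]
  obtain ⟨γ, hγ₀, hγ⟩ := exists_isIntegralCurve_of_hasCompactSupport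
    (χ.contDiff.smul hF) χ.hasCompactSupport.smul_right x₀
  have htraj : IsTrajectory (fun x => χ x • F x) γ := hγ.isIntegralCurveOn _
  refine ⟨γ, hγ₀, fun t ht => ?_⟩
  have hball : γ t ⬝ᵥ γ t ≤ R :=
    htraj.dotProduct_self_le (fun x hx => by rw [hχ x hx.le]; exact hR x hx) (by rwa [hγ₀]) ht
  simpa only [hχ _ hball] using htraj t ht

end Dissipative

section PlanarMatrix

theorem discr_nonneg_of_mul_nonneg {R : Type*} [CommRing R] [LinearOrder R] [IsStrictOrderedRing R]
    {A : Matrix (Fin 2) (Fin 2) R} (hA : 0 ≤ A 0 1 * A 1 0) : 0 ≤ A.discr := by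
  rw [Matrix.discr_fin_two, Matrix.trace_fin_two, Matrix.det_fin_two]
  linarith [sq_nonneg (A 0 0 - A 1 1)]

variable {A : Matrix (Fin 2) (Fin 2) ℝ}

theorem exists_charpoly_roots_eq_of_discr_nonneg (hA : 0 ≤ A.discr) :
    ∃ μ₁ μ₂, μ₁ ≤ μ₂ ∧ μ₁ + μ₂ = A.trace ∧ μ₁ * μ₂ = A.det ∧ A.charpoly.roots = {μ₁, μ₂} := by
  have hsq : √A.discr ^ 2 = A.trace ^ 2 - 4 * A.det :=
    (Real.sq_sqrt hA).trans A.discr_fin_two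
  set μ₁ := (A.trace - √A.discr) / 2
  set μ₂ := (A.trace + √A.discr) / 2
  have hsum : μ₁ + μ₂ = A.trace := by ring
  have hprod : μ₁ * μ₂ = A.det := by linear_combination -hsq / 4
  refine ⟨μ₁, μ₂, ?_, hsum, hprod, ?_⟩
  · exact div_le_div_of_nonneg_right (by linarith [Real.sqrt_nonneg A.discr]) zero_le_two
  · have hroots := (Polynomial.roots_quadratic_eq_pair_iff_of_ne_zero (a := 1) (b := -A.trace)
      (c := A.det) (x1 := μ₁) (x2 := μ₂) one_ne_zero).2
      ⟨by linear_combination hsum, by linear_combination -hprod⟩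
    rw [Matrix.charpoly_fin_two, ← hroots]
    congr 1
    simp only [map_one, one_mul, map_neg, neg_mul]
    ring

theorem exists_charpoly_roots_eq_of_det_neg (hdet : A.det < 0) :
    ∃ μ₁ μ₂, μ₁ < 0 ∧ 0 < μ₂ ∧ A.charpoly.roots = {μ₁, μ₂} := by
  have hdiscr : 0 ≤ A.discr := by
    rw [Matrix.discr_fin_two]
    linarith [sq_nonneg A.trace]
  obtain ⟨μ₁, μ₂, hle, -, hprod, hroots⟩ := exists_charpoly_roots_eq_of_discr_nonneg hdiscr
  rcases mul_neg_iff.1 (hprod.trans_lt hdet) with ⟨hpos, hneg⟩ | ⟨hneg, hpos⟩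
  · exact absurd (hneg.trans hpos) hle.not_gt
  · exact ⟨μ₁, μ₂, hneg, hpos, hroots⟩

theorem exists_charpoly_roots_eq_of_trace_neg_of_det_pos (hdiscr : 0 ≤ A.discr)
    (htrace : A.trace < 0) (hdet : 0 < A.det) :
    ∃ μ₁ μ₂, μ₁ < 0 ∧ μ₂ < 0 ∧ A.charpoly.roots = {μ₁, μ₂} := by
  obtain ⟨μ₁, μ₂, hle, hsum, hprod, hroots⟩ := exists_charpoly_roots_eq_of_discr_nonneg hdiscr
  have hneg : μ₁ < 0 := by linarith
  exact ⟨μ₁, μ₂, hneg, neg_of_mul_pos_right (hprod ▸ hdet) hneg.le, hroots⟩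

theorem hasInertia_of_det_neg (hdet : A.det < 0) : HasInertia A 1 0 1 := by
  obtain ⟨μ₁, μ₂, hneg, hpos, hroots⟩ := exists_charpoly_roots_eq_of_det_neg hdet
  simp [HasInertia, hroots, ← Multiset.cons_zero, hneg, hpos,
    hneg.not_gt, hpos.not_gt, hneg.ne, hpos.ne']

end PlanarMatrix

section Passivity

open Matrix

theorem blockForm_fromBlocks {k l : ℕ} (A : Matrix (Fin k) (Fin k) ℝ)
    (B : Matrix (Fin k) (Fin l) ℝ) (C : Matrix (Fin l) (Fin k) ℝ) (D : Matrix (Fin l) (Fin l) ℝ)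
    (v : Fin k → ℝ) (w : Fin l → ℝ) :
    blockForm (fromBlocks A B C D) v w =
      v ⬝ᵥ A *ᵥ v + v ⬝ᵥ B *ᵥ w + (w ⬝ᵥ C *ᵥ v + w ⬝ᵥ D *ᵥ w) := by
  rw [blockForm, fromBlocks_mulVec, sumElim_dotProduct_sumElim]
  simp only [Sum.elim_comp_inl, Sum.elim_comp_inr, dotProduct_add]

theorem blockForm_storage {n : ℕ} {P : Matrix (Fin n) (Fin n) ℝ} (hP : P.IsSymm) (lam ε : ℝ)
    (w v : Fin n → ℝ) :
    blockForm (fromBlocks 0 P P ((2 * lam) • P + ε • (1 : Matrix (Fin n) (Fin n) ℝ))) w v =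
      2 * (v ⬝ᵥ P *ᵥ (w + lam • v)) + ε * (v ⬝ᵥ v) := by
  have hsymm : w ⬝ᵥ P *ᵥ v = v ⬝ᵥ P *ᵥ w := by
    rw [dotProduct_comm, dotProduct_mulVec, ← mulVec_transpose, hP.eq]
  simp only [blockForm_fromBlocks, zero_mulVec, dotProduct_zero, add_mulVec, smul_mulVec,
    one_mulVec, mulVec_add, mulVec_smul, dotProduct_add, dotProduct_smul, smul_eq_mul, hsymm]
  ring

theorem blockForm_supply {m : ℕ} (y u : Fin m → ℝ) :
    blockForm (fromBlocks 0 1 1 0) y u = 2 * (y ⬝ᵥ u) := by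
  simp only [blockForm_fromBlocks, zero_mulVec, one_mulVec, dotProduct_zero, dotProduct_comm u y]
  ring

end Passivity

section LoadLine

theorem exists_forall_mul_sq_sub_le_mul {φ : ℝ → ℝ} (hφ : Continuous φ) {k r : ℝ}
    (hk : ∀ y, r < |y| → k * y ^ 2 ≤ y * φ y) : ∃ D, ∀ y, k * y ^ 2 - D ≤ y * φ y := by
  obtain ⟨D, hD⟩ := (isCompact_closedBall (0 : ℝ) r).exists_bound_of_continuousOn
    (f := fun y => k * y ^ 2 - y * φ y) (by fun_prop)
  refine ⟨max D 0, fun y => ?_⟩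
  rcases le_or_gt |y| r with hy | hy
  · have hDy := (le_abs_self _).trans (hD y (mem_closedBall_zero_iff.2 hy))
    linarith [le_max_left D 0]
  · linarith [hk y hy, le_max_right D 0]

theorem eventually_lt_mul_of_hasDerivAt {φ : ℝ → ℝ} {φ' κ : ℝ} (hφ : HasDerivAt φ φ' 0)
    (h₀ : φ 0 = 0) (hκ : φ' < κ) : ∀ᶠ y in 𝓝[>] 0, φ y < κ * y := by
  filter_upwards [hφ.hasDerivWithinAt.limsup_slope_le' self_notMem_Ioi hκ, self_mem_nhdsWithin]
    with y hslope hy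
  rw [slope_def_field, h₀, sub_zero, sub_zero] at hslope
  exact (div_lt_iff₀ hy).1 hslope

theorem lt_slope_of_lt_mul_of_eq_mul {φ : ℝ → ℝ} {κ x y : ℝ} (hxy : x < y) (hx : φ x < κ * x)
    (hy : φ y = κ * y) : κ < slope φ x y := by
  rw [slope_def_field, lt_div_iff₀ (sub_pos.2 hxy)]
  linarith

theorem lt_derivative_of_convexOn {φ : ℝ → ℝ} {φ' κ x y : ℝ} {S : Set ℝ} (hφ : ConvexOn ℝ S φ)
    (hxS : x ∈ S) (hyS : y ∈ S) (hxy : x < y) (hx : φ x < κ * x) (hy : φ y = κ * y)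
    (hφ' : HasDerivAt φ φ' y) : κ < φ' :=
  (lt_slope_of_lt_mul_of_eq_mul hxy hx hy).trans_le (hφ.slope_le_of_hasDerivAt hxS hyS hxy hφ')

theorem mul_lt_of_convexOn {φ : ℝ → ℝ} {κ x y z : ℝ} {S : Set ℝ} (hφ : ConvexOn ℝ S φ)
    (hxS : x ∈ S) (hzS : z ∈ S) (hxy : x < y) (hyz : y < z) (hx : φ x < κ * x)
    (hy : φ y = κ * y) : κ * z < φ z := by
  have hslope := hφ.slope_mono_adjacent hxS hzS hxy hyz
  rw [← slope_def_field, le_div_iff₀ (sub_pos.2 hyz)] at hslope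
  have hκ := lt_slope_of_lt_mul_of_eq_mul hxy hx hy
  linarith [mul_lt_mul_of_pos_right hκ (sub_pos.2 hyz)]

theorem eq_of_convexOn_of_eq_mul {φ : ℝ → ℝ} {κ y z : ℝ} (hφ : ConvexOn ℝ (Ici 0) φ)
    (hlt : ∀ᶠ x in 𝓝[>] 0, φ x < κ * x) (hy₀ : 0 < y) (hz₀ : 0 < z) (hy : φ y = κ * y)
    (hz : φ z = κ * z) : y = z := by
  wlog hyz : y < z generalizing y z
  · by_contra hne
    exact hne (this hz₀ hy₀ hz hy ((not_lt.1 hyz).lt_of_ne' hne)).symm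
  obtain ⟨x, hx, hx₀, hxy⟩ := (hlt.and (Ioo_mem_nhdsGT hy₀)).exists
  exact absurd hz (mul_lt_of_convexOn hφ hx₀.le hz₀.le hxy hyz hx hy).ne'

theorem setOf_eq_mul_eq_of_odd_of_convexOn {φ : ℝ → ℝ} {κ e : ℝ} (hodd : Function.Odd φ)
    (hφ : ConvexOn ℝ (Ici 0) φ) (hlt : ∀ᶠ x in 𝓝[>] 0, φ x < κ * x) (he₀ : 0 < e)
    (he : φ e = κ * e) : {y | φ y = κ * y} = {e, -e, 0} := by
  have hneg : ∀ {y}, φ y = κ * y → φ (-y) = κ * -y := fun hy => by rw [hodd, hy, mul_neg]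
  refine Subset.antisymm (fun y hy => ?_) ?_
  · rcases lt_trichotomy y 0 with hy₀ | rfl | hy₀
    · exact .inr (.inl (neg_eq_iff_eq_neg.1
        (eq_of_convexOn_of_eq_mul hφ hlt (neg_pos.2 hy₀) he₀ (hneg hy) he)))
    · exact .inr (.inr rfl)
    · exact .inl (eq_of_convexOn_of_eq_mul hφ hlt hy₀ he₀ hy he)
  · rintro y (rfl | rfl | rfl)
    · exact he
    · exact hneg he
    · exact hodd.map_zero.trans (mul_zero κ).symm

end LoadLine

namespace IsSaturation

variable {φ : ℝ → ℝ}

theorem differentiable (hφ : IsSaturation φ) : Differentiable ℝ φ :=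
  hφ.contDiff.differentiable one_ne_zero

theorem exists_forall_mul_sq_sub_le_mul (hφ : IsSaturation φ) {k : ℝ} (hk : 0 < k) :
    ∃ D, ∀ y, k * y ^ 2 - D ≤ y * φ y := by
  obtain ⟨r, -, hr⟩ := hφ.dominates k hk
  exact OpAmp.exists_forall_mul_sq_sub_le_mul hφ.contDiff.continuous
    fun y hy => (sub_pos.1 (hr y hy)).le

theorem eventually_lt_mul (hφ : IsSaturation φ) {κ : ℝ} (hκ : deriv φ 0 < κ) :
    ∀ᶠ y in 𝓝[>] 0, φ y < κ * y :=
  eventually_lt_mul_of_hasDerivAt (hφ.differentiable 0).hasDerivAt (Function.Odd.map_zero hφ.odd) hκ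

theorem exists_pos_mul_lt (hφ : IsSaturation φ) (κ : ℝ) : ∃ y > 0, κ * y < φ y := by
  obtain ⟨r, hr, hdom⟩ := hφ.dominates (|κ| + 1) (by positivity)
  have hpos : 0 < r + 1 := by linarith
  have hmul := hdom (r + 1) (by rw [abs_of_pos hpos]; linarith)
  refine ⟨r + 1, hpos, lt_of_mul_lt_mul_left ?_ hpos.le⟩
  nlinarith [le_abs_self κ]

theorem exists_pos_eq_mul (hφ : IsSaturation φ) {κ : ℝ} (hκ : deriv φ 0 < κ) :
    ∃ y > 0, φ y = κ * y := by
  obtain ⟨x, hx, hx₀⟩ := ((hφ.eventually_lt_mul hκ).and self_mem_nhdsWithin).exists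
  obtain ⟨z, hz₀, hz⟩ := hφ.exists_pos_mul_lt κ
  exact isPreconnected_Ioi.intermediate_value₂ hx₀ hz₀ hφ.contDiff.continuous.continuousOn
    (continuous_const_mul κ).continuousOn hx.le hz.le

theorem convexOn (hφ : IsSaturation φ) (hstiff : IsStiffening φ) : ConvexOn ℝ (Ici 0) φ :=
  MonotoneOn.convexOn_of_deriv (convex_Ici 0) hφ.contDiff.continuous.continuousOn
    hφ.differentiable.differentiableOn (hstiff.mono interior_subset)

theorem deriv_neg (hφ : IsSaturation φ) (y : ℝ) : deriv φ (-y) = deriv φ y := by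
  have hodd : (fun x => φ (-x)) = fun x => -φ x := funext hφ.odd
  rw [← neg_inj, ← deriv_comp_neg, hodd, deriv.fun_neg]

theorem lt_deriv_of_eq_mul (hφ : IsSaturation φ) (hstiff : IsStiffening φ) {κ y : ℝ}
    (hκ : deriv φ 0 < κ) (hy₀ : 0 < y) (hy : φ y = κ * y) : κ < deriv φ y := by
  obtain ⟨x, hx, hx₀, hxy⟩ := ((hφ.eventually_lt_mul hκ).and (Ioo_mem_nhdsGT hy₀)).exists
  exact lt_derivative_of_convexOn (hφ.convexOn hstiff) hx₀.le hy₀.le hxy hx hy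
    (hφ.differentiable y).hasDerivAt

theorem setOf_eq_mul_eq (hφ : IsSaturation φ) (hstiff : IsStiffening φ) {κ e : ℝ}
    (hκ : deriv φ 0 < κ) (he₀ : 0 < e) (he : φ e = κ * e) :
    {y | φ y = κ * y} = {e, -e, 0} :=
  setOf_eq_mul_eq_of_odd_of_convexOn hφ.odd (hφ.convexOn hstiff) (hφ.eventually_lt_mul hκ) he₀ he

end IsSaturation

theorem OpenSystem.jacobian_field {n m q : ℕ} (S : OpenSystem n m q) (u : Fin m → ℝ)
    (x : Fin n → ℝ) : jacobian (S.field u) x = jacobian S.f x := by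
  have hfderiv : fderiv ℝ (S.field u) x = fderiv ℝ S.f x := fderiv_add_const _
  rw [jacobian, jacobian, hfderiv]

namespace Params

open Matrix

variable (c : Params) {φ : ℝ → ℝ}

theorem a_pos : 0 < c.a := by
  have := c.R₁_pos; have := c.Ra_pos; have := c.C₁_pos
  unfold a
  positivity

theorem b_pos : 0 < c.b := by
  have := c.Ra_pos; have := c.C₁_pos
  unfold b
  positivity

/-- The slope of the load line: the equilibria of the closed loop are the intersections of the
graph of the nonlinearity with a line of this slope. -/
noncomputable def loadSlope : ℝ := -(1 / c.R₀) + c.α * c.R₁ / (c.R₁ + c.Ra)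

theorem loadSlope_eq : c.loadSlope = -(1 / c.R₀) + c.α * (c.b / c.a) := by
  have := c.R₁_pos; have := c.Ra_pos; have := c.C₁_pos
  unfold loadSlope a b
  field_simp

section Linearization

/-- The Jacobian matrix of the closed loop at a state with output `x`, where `m` stands for the
slope `deriv φ x` of the nonlinearity. -/
noncomputable def jac (m : ℝ) : Matrix (Fin 2) (Fin 2) ℝ :=
  !![-(1 / (c.R₀ * c.C₀)) - 1 / c.C₀ * m, c.α / c.C₀; c.b, -c.a]

theorem jac_mulVec (m : ℝ) (v : Fin 2 → ℝ) :
    c.jac m *ᵥ v = ![(-(1 / (c.R₀ * c.C₀)) - 1 / c.C₀ * m) * v 0 + c.α / c.C₀ * v 1,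
      c.b * v 0 + -c.a * v 1] := by
  ext i
  fin_cases i <;> simp [jac, mulVec, dotProduct, Fin.sum_univ_two]

theorem hasFDerivAt_closedLoop_f {s : Fin 2 → ℝ} (hφ : DifferentiableAt ℝ φ (s 0)) :
    HasFDerivAt (c.closedLoop φ).f (c.jac (deriv φ (s 0))).toLin'.toContinuousLinearMap s := by
  have hx : HasFDerivAt (fun s : Fin 2 → ℝ => s 0) (ContinuousLinearMap.proj 0) s :=
    hasFDerivAt_apply (𝕜 := ℝ) 0 s
  have hz : HasFDerivAt (fun s : Fin 2 → ℝ => s 1) (ContinuousLinearMap.proj 1) s :=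
    hasFDerivAt_apply (𝕜 := ℝ) 1 s
  refine hasFDerivAt_pi'.2 (Fin.forall_fin_two.2 ⟨?_, ?_⟩)
  · refine (((hx.const_mul (-(1 / (c.R₀ * c.C₀)))).sub
      ((hφ.hasDerivAt.comp_hasFDerivAt s hx).const_mul (1 / c.C₀))).add
      (hz.const_mul (c.α / c.C₀))).congr_fderiv ?_
    ext v
    simp only [_root_.add_apply, _root_.sub_apply, _root_.smul_apply, smul_eq_mul,
      ContinuousLinearMap.proj_apply, ContinuousLinearMap.comp_apply,
      LinearMap.coe_toContinuousLinearMap', toLin'_apply, jac_mulVec, cons_val_zero]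
    ring
  · refine ((hz.const_mul (-c.a)).add (hx.const_mul c.b)).congr_fderiv ?_
    ext v
    simp only [_root_.add_apply, _root_.smul_apply, smul_eq_mul,
      ContinuousLinearMap.proj_apply, ContinuousLinearMap.comp_apply,
      LinearMap.coe_toContinuousLinearMap', toLin'_apply, jac_mulVec, cons_val_one,
      cons_val_fin_one]
    ring

theorem differentiableAt_field (Vr : ℝ) {s : Fin 2 → ℝ} (hφ : DifferentiableAt ℝ φ (s 0)) :
    DifferentiableAt ℝ ((c.closedLoop φ).field ![Vr]) s :=
  (c.hasFDerivAt_closedLoop_f hφ).differentiableAt.add_const _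

theorem jacobian_closedLoop_f {s : Fin 2 → ℝ} (hφ : DifferentiableAt ℝ φ (s 0)) :
    jacobian (c.closedLoop φ).f s = c.jac (deriv φ (s 0)) := by
  rw [jacobian, (c.hasFDerivAt_closedLoop_f hφ).fderiv]
  exact LinearMap.toMatrix'_toLin' _

theorem jacobian_field (Vr : ℝ) {s : Fin 2 → ℝ} (hφ : DifferentiableAt ℝ φ (s 0)) :
    jacobian ((c.closedLoop φ).field ![Vr]) s = c.jac (deriv φ (s 0)) := by
  rw [OpenSystem.jacobian_field, c.jacobian_closedLoop_f hφ]

theorem det_jac (m : ℝ) : (c.jac m).det = c.a / c.C₀ * (m - c.loadSlope) := by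
  have := c.R₀_pos; have := c.C₀_pos; have := c.a_pos
  rw [loadSlope_eq, jac, det_fin_two_of]
  field_simp
  ring

theorem trace_jac (m : ℝ) : (c.jac m).trace = -(1 / c.C₀ * (m + 1 / c.R₀)) - c.a := by
  have := c.R₀_pos; have := c.C₀_pos
  rw [jac, trace_fin_two_of]
  field_simp
  ring

theorem discr_jac_nonneg (m : ℝ) : 0 ≤ (c.jac m).discr := by
  have := c.C₀_pos; have := c.α_pos; have := c.b_pos
  refine discr_nonneg_of_mul_nonneg (?_ : 0 ≤ c.α / c.C₀ * c.b)
  positivity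

theorem trace_jac_neg {m : ℝ} (hm : c.loadSlope < m) : (c.jac m).trace < 0 := by
  have hC₀ := c.C₀_pos; have := c.α_pos; have ha := c.a_pos; have := c.b_pos
  have hgain : 0 < c.α * (c.b / c.a) := by positivity
  rw [loadSlope_eq] at hm
  rw [trace_jac]
  have hslope : 0 < 1 / c.C₀ * (m + 1 / c.R₀) := mul_pos (one_div_pos.2 hC₀) (by linarith)
  linarith

theorem isSaddle_of_deriv_lt {Vr : ℝ} {s : Fin 2 → ℝ} (hφ : DifferentiableAt ℝ φ (s 0))
    (hs : (c.closedLoop φ).field ![Vr] s = 0) (hlt : deriv φ (s 0) < c.loadSlope) :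
    IsSaddle ((c.closedLoop φ).field ![Vr]) s := by
  refine ⟨hs, c.differentiableAt_field Vr hφ, ?_⟩
  rw [c.jacobian_field Vr hφ]
  refine exists_charpoly_roots_eq_of_det_neg ?_
  rw [det_jac]
  exact mul_neg_of_pos_of_neg (div_pos c.a_pos c.C₀_pos) (sub_neg.2 hlt)

theorem isStableNode_of_lt_deriv {Vr : ℝ} {s : Fin 2 → ℝ} (hφ : DifferentiableAt ℝ φ (s 0))
    (hs : (c.closedLoop φ).field ![Vr] s = 0) (hlt : c.loadSlope < deriv φ (s 0)) :
    IsStableNode ((c.closedLoop φ).field ![Vr]) s := by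
  refine ⟨hs, c.differentiableAt_field Vr hφ, ?_⟩
  rw [c.jacobian_field Vr hφ]
  refine exists_charpoly_roots_eq_of_trace_neg_of_det_pos (c.discr_jac_nonneg _)
    (c.trace_jac_neg hlt) ?_
  rw [det_jac]
  exact mul_pos (div_pos c.a_pos c.C₀_pos) (sub_pos.2 hlt)

end Linearization

section Passivity

/-- The matrix of the quadratic storage of the closed loop. Its weights make the contributions of
the two couplings `α / C₀` and `b` cancel, and normalize the supply to `V_r V₀`. -/
noncomputable def storage : Matrix (Fin 2) (Fin 2) ℝ :=
  Matrix.diagonal ![c.C₀ / c.α, -(1 / c.b)]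

theorem isSymm_storage : c.storage.IsSymm :=
  isSymm_diagonal _

theorem hasInertia_storage : HasInertia c.storage 1 0 1 := by
  have := c.C₀_pos; have := c.α_pos; have := c.b_pos
  have hpos : 0 < c.C₀ / c.α * (1 / c.b) := by positivity
  refine hasInertia_of_det_neg ?_
  rw [storage, det_diagonal, Fin.prod_univ_two]
  simpa using hpos

theorem closedLoop_B_mulVec (φ : ℝ → ℝ) (w : Fin 1 → ℝ) :
    (c.closedLoop φ).B *ᵥ w = ![c.α / c.C₀ * w 0, 0] := by
  ext i
  fin_cases i <;> simp [closedLoop, mulVec, dotProduct]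

theorem closedLoop_C_mulVec_dotProduct (φ : ℝ → ℝ) (v : Fin 2 → ℝ) (w : Fin 1 → ℝ) :
    (c.closedLoop φ).C *ᵥ v ⬝ᵥ w = v 0 * w 0 := by
  simp [closedLoop, dotProduct]

theorem dotProduct_storage_mulVec (φ : ℝ → ℝ) (lam m : ℝ) (v : Fin 2 → ℝ) (w : Fin 1 → ℝ) :
    v ⬝ᵥ c.storage *ᵥ (c.jac m *ᵥ v + (c.closedLoop φ).B *ᵥ w + lam • v) =
      (c.closedLoop φ).C *ᵥ v ⬝ᵥ w - 1 / c.α * m * v 0 ^ 2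
        - c.C₀ / c.α * (1 / (c.R₀ * c.C₀) - lam) * v 0 ^ 2 - 1 / c.b * (lam - c.a) * v 1 ^ 2 := by
  have := c.R₀_pos; have := c.C₀_pos; have := c.α_pos; have := c.b_pos
  rw [jac_mulVec, closedLoop_B_mulVec, closedLoop_C_mulVec_dotProduct, storage, vec2_dotProduct]
  simp only [mulVec_diagonal, Pi.add_apply, Pi.smul_apply, smul_eq_mul, cons_val_zero, cons_val_one,
    cons_val_fin_one]
  field_simp
  ring

theorem isStrictlyPassive_closedLoop (hφ : Differentiable ℝ φ) (hφ' : ∀ y, 0 ≤ deriv φ y)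
    {lam : ℝ} (ha : c.a < lam) (hR₀ : lam < 1 / (c.R₀ * c.C₀)) :
    (c.closedLoop φ).IsStrictlyPassive 1 lam := by
  have := c.C₀_pos; have := c.α_pos; have := c.b_pos
  set p := c.C₀ / c.α * (1 / (c.R₀ * c.C₀) - lam) with hp
  set q := 1 / c.b * (lam - c.a) with hq
  have hp₀ : 0 < p := mul_pos (by positivity) (sub_pos.2 hR₀)
  have hq₀ : 0 < q := mul_pos (by positivity) (sub_pos.2 ha)
  refine ⟨c.a_pos.le.trans ha.le, fun s => (c.hasFDerivAt_closedLoop_f (hφ _)).differentiableAt,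
    c.storage, 2 * min p q, c.isSymm_storage, c.hasInertia_storage,
    mul_pos two_pos (lt_min hp₀ hq₀), fun s v w => ?_⟩
  rw [blockForm_storage c.isSymm_storage, blockForm_supply, c.jacobian_closedLoop_f (hφ _),
    dotProduct_storage_mulVec, ← hp, ← hq, vec2_dotProduct v]
  have hmono : 0 ≤ 1 / c.α * deriv φ (s 0) * v 0 ^ 2 := by
    have := hφ' (s 0)
    positivity
  have hx := mul_le_mul_of_nonneg_right (min_le_left p q) (sq_nonneg (v 0))
  have hz := mul_le_mul_of_nonneg_right (min_le_right p q) (sq_nonneg (v 1))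
  linarith

end Passivity

section Convergence

theorem contDiff_field (hφ : ContDiff ℝ 1 φ) (Vr : ℝ) :
    ContDiff ℝ 1 ((c.closedLoop φ).field ![Vr]) := by
  simp only [funext (c.closedLoop_field φ Vr), opAmpRate, networkRate]
  refine contDiff_pi.2 (Fin.forall_fin_two.2 ⟨?_, ?_⟩)
  · simp only [Matrix.cons_val_zero]
    fun_prop
  · simp only [Matrix.cons_val_one, Matrix.cons_val_fin_one]
    fun_prop

theorem isCooperative_field (hφ : Differentiable ℝ φ) (Vr : ℝ) :
    IsCooperative ((c.closedLoop φ).field ![Vr]) := by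
  have hgain : 0 ≤ c.α / c.C₀ := (div_pos c.α_pos c.C₀_pos).le
  intro s i j hij
  rw [c.jacobian_field Vr (hφ _)]
  fin_cases i <;> fin_cases j <;> simp_all [jac, c.b_pos.le]

theorem isEventuallyInward_field (hφ : ∀ k > 0, ∃ D, ∀ y, k * y ^ 2 - D ≤ y * φ y) (Vr : ℝ) :
    IsEventuallyInward ((c.closedLoop φ).field ![Vr]) := by
  have hR₀ := c.R₀_pos; have hC₀ := c.C₀_pos; have ha := c.a_pos
  set g := c.α / c.C₀
  set K := (g + c.b) ^ 2 / (2 * c.a) + c.a / 2 + 1 / 2 with hK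
  obtain ⟨D, hD⟩ := hφ (c.C₀ * K) (by positivity)
  refine isEventuallyInward_of_le (D := D / c.C₀ + (g * Vr) ^ 2 / 2) (half_pos ha) fun s => ?_
  rw [closedLoop_field, opAmpRate, networkRate]
  simp only [dotProduct, Fin.sum_univ_two, Matrix.cons_val_zero, Matrix.cons_val_one,
    Matrix.cons_val_fin_one]
  set x := s 0
  set z := s 1
  have hdamping : K * x ^ 2 - D / c.C₀ ≤ 1 / c.C₀ * (x * φ x) := by
    calc K * x ^ 2 - D / c.C₀ = 1 / c.C₀ * (c.C₀ * K * x ^ 2 - D) := by field_simp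
      _ ≤ 1 / c.C₀ * (x * φ x) := by gcongr; exact hD x
  have hcoupling : (g + c.b) * (x * z) ≤ c.a / 2 * z ^ 2 + (g + c.b) ^ 2 / (2 * c.a) * x ^ 2 := by
    have hsq : 0 ≤ (c.a * z - (g + c.b) * x) ^ 2 / (2 * c.a) := by positivity
    refine sub_nonneg.1 (hsq.trans_eq ?_)
    field_simp
    ring
  have hinput : g * Vr * x ≤ (g * Vr) ^ 2 / 2 + x ^ 2 / 2 := by
    linarith [two_mul_le_add_sq (g * Vr) x]
  have hleak : 0 ≤ 1 / (c.R₀ * c.C₀) * x ^ 2 := by positivity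
  rw [hK] at hdamping
  linarith

end Convergence

section Equilibria

/-- The state at which the network is at rest with output `x`. It is an equilibrium of the closed
loop exactly when `(x, φ x)` lies on the load line. -/
noncomputable def equilibrium (x : ℝ) : Fin 2 → ℝ := x • ![1, c.b / c.a]

theorem equilibrium_apply_zero (x : ℝ) : c.equilibrium x 0 = x := by
  simp [equilibrium]

theorem equilibrium_injective : Function.Injective c.equilibrium :=
  Function.LeftInverse.injective (g := fun s : Fin 2 → ℝ => s 0) c.equilibrium_apply_zero

theorem equilibrium_zero : c.equilibrium 0 = 0 :=
  zero_smul ℝ _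

theorem equilibrium_neg (x : ℝ) : c.equilibrium (-x) = -c.equilibrium x :=
  neg_smul x _

theorem networkRate_eq_zero_iff {z x : ℝ} : c.networkRate z x = 0 ↔ z = c.b / c.a * x := by
  have := c.a_pos
  rw [networkRate, div_mul_eq_mul_div, eq_div_iff this.ne']
  constructor <;> intro h <;> linarith

theorem opAmpRate_eq_zero_iff (φ : ℝ → ℝ) (x Vr : ℝ) :
    c.opAmpRate φ x (c.b / c.a * x + Vr) = 0 ↔ φ x = c.loadSlope * x + c.α * Vr := by
  have := c.R₀_pos; have hC₀ := c.C₀_pos; have := c.a_pos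
  have hrate : c.opAmpRate φ x (c.b / c.a * x + Vr) =
      1 / c.C₀ * (c.loadSlope * x + c.α * Vr - φ x) := by
    rw [opAmpRate, loadSlope_eq]
    field_simp
    ring
  rw [hrate, mul_eq_zero, or_iff_right (one_div_pos.2 hC₀).ne', sub_eq_zero, eq_comm]

theorem setOf_field_eq_zero (φ : ℝ → ℝ) (Vr : ℝ) :
    {s | (c.closedLoop φ).field ![Vr] s = 0} =
      c.equilibrium '' {x | φ x = c.loadSlope * x + c.α * Vr} := by
  ext s
  have hs : c.equilibrium (s 0) = s ↔ c.networkRate (s 1) (s 0) = 0 := by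
    rw [networkRate_eq_zero_iff, funext_iff, Fin.forall_fin_two]
    simp [equilibrium, mul_comm, eq_comm]
  have hfield : (c.closedLoop φ).field ![Vr] s = 0 ↔
      c.opAmpRate φ (s 0) (s 1 + Vr) = 0 ∧ c.networkRate (s 1) (s 0) = 0 := by
    rw [closedLoop_field, funext_iff, Fin.forall_fin_two]
    rfl
  rw [mem_ofPred_eq, hfield]
  constructor
  · rintro ⟨hx, hz⟩
    rw [c.networkRate_eq_zero_iff.1 hz, opAmpRate_eq_zero_iff] at hx
    exact ⟨s 0, hx, hs.2 hz⟩
  · rintro ⟨x, hx, rfl⟩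
    rw [equilibrium_apply_zero] at hs ⊢
    have hz := hs.1 rfl
    refine ⟨?_, hz⟩
    rw [c.networkRate_eq_zero_iff.1 hz]
    exact (c.opAmpRate_eq_zero_iff φ x Vr).2 hx

theorem field_equilibrium {x : ℝ} (hx : φ x = c.loadSlope * x) :
    (c.closedLoop φ).field ![0] (c.equilibrium x) = 0 := by
  refine (c.setOf_field_eq_zero φ 0).ge (mem_image_of_mem _ ?_)
  rw [mem_ofPred_eq, mul_zero, add_zero, hx]

theorem isSaddle_zero (hφ : DifferentiableAt ℝ φ 0) (h₀ : φ 0 = 0)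
    (hlt : deriv φ 0 < c.loadSlope) : IsSaddle ((c.closedLoop φ).field ![0]) 0 := by
  refine c.isSaddle_of_deriv_lt hφ ?_ hlt
  have hfield := c.field_equilibrium (φ := φ) (x := 0) (by rw [h₀, mul_zero])
  rwa [equilibrium_zero] at hfield

theorem exists_ne_zero_field_eq_zero (hφ : IsSaturation φ) (hlt : deriv φ 0 < c.loadSlope) :
    ∃ e, e ≠ 0 ∧ (c.closedLoop φ).field ![0] e = 0 ∧ (c.closedLoop φ).field ![0] (-e) = 0 := by
  obtain ⟨y, hy₀, hy⟩ := hφ.exists_pos_eq_mul hlt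
  refine ⟨c.equilibrium y, ?_, c.field_equilibrium hy, ?_⟩
  · rw [← c.equilibrium_zero]
    exact c.equilibrium_injective.ne hy₀.ne'
  · rw [← c.equilibrium_neg]
    exact c.field_equilibrium (by rw [hφ.odd, hy, mul_neg])

theorem isBistable_of_isStiffening (hφ : IsSaturation φ) (hstiff : IsStiffening φ)
    (hlt : deriv φ 0 < c.loadSlope) : IsBistable ((c.closedLoop φ).field ![0]) := by
  obtain ⟨y, hy₀, hy⟩ := hφ.exists_pos_eq_mul hlt
  have hset := hφ.setOf_eq_mul_eq hstiff hlt hy₀ hy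
  have hslope := hφ.lt_deriv_of_eq_mul hstiff hlt hy₀ hy
  have hnode : ∀ {x}, φ x = c.loadSlope * x → c.loadSlope < deriv φ x →
      IsStableNode ((c.closedLoop φ).field ![0]) (c.equilibrium x) := fun hx hx' =>
    c.isStableNode_of_lt_deriv (hφ.differentiable _) (c.field_equilibrium hx)
      (by rwa [equilibrium_apply_zero])
  refine ⟨c.equilibrium y, c.equilibrium (-y), c.equilibrium 0,
    c.equilibrium_injective.ne (by linarith), c.equilibrium_injective.ne hy₀.ne',
    c.equilibrium_injective.ne (by linarith), ?_, hnode hy hslope,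
    hnode (by rw [hφ.odd, hy, mul_neg]) (by rwa [hφ.deriv_neg]), ?_⟩
  · simp only [setOf_field_eq_zero, mul_zero, add_zero, hset, image_insert_eq, image_singleton]
  · rw [equilibrium_zero]
    exact c.isSaddle_zero (hφ.differentiable 0) (Function.Odd.map_zero hφ.odd) hlt

end Equilibria

end Params
end OpAmp

theorem mainTheorem4_general (c : OpAmp.Params) (φ : ℝ → ℝ) (hφ : OpAmp.IsSaturation φ) :
    (∀ lam ∈ Set.Ioo c.a (1 / (c.R₀ * c.C₀)), (c.closedLoop φ).IsStrictlyPassive 1 lam) ∧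
    (∀ Vr : ℝ,
      (∀ s₀ : Fin 2 → ℝ, ∃ γ : ℝ → (Fin 2 → ℝ), γ 0 = s₀ ∧
        OpAmp.IsTrajectory ((c.closedLoop φ).field ![Vr]) γ) ∧
      (∀ γ : ℝ → (Fin 2 → ℝ), OpAmp.IsTrajectory ((c.closedLoop φ).field ![Vr]) γ →
        ∃ e : Fin 2 → ℝ, (c.closedLoop φ).field ![Vr] e = 0 ∧
          Filter.Tendsto γ Filter.atTop (nhds e))) ∧
    (deriv φ 0 < -(1 / c.R₀) + c.α * c.R₁ / (c.R₁ + c.Ra) →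
      OpAmp.IsSaddle ((c.closedLoop φ).field ![0]) 0 ∧
      (∃ e : Fin 2 → ℝ, e ≠ 0 ∧ (c.closedLoop φ).field ![0] e = 0 ∧
        (c.closedLoop φ).field ![0] (-e) = 0) ∧
      (OpAmp.IsStiffening φ → OpAmp.IsBistable ((c.closedLoop φ).field ![0]))) := by
  have hdiff := hφ.differentiable
  refine ⟨fun lam ⟨ha, hR₀⟩ => c.isStrictlyPassive_closedLoop hdiff hφ.deriv_nonneg ha hR₀,
    fun Vr => ?_, fun hlt => ⟨?_, c.exists_ne_zero_field_eq_zero hφ hlt,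
      fun hstiff => c.isBistable_of_isStiffening hφ hstiff hlt⟩⟩
  · have hC1 := c.contDiff_field hφ.contDiff Vr
    have hinward := c.isEventuallyInward_field (fun _ => hφ.exists_forall_mul_sq_sub_le_mul) Vr
    exact ⟨hinward.exists_isTrajectory hC1, fun γ hγ =>
      (c.isCooperative_field hdiff Vr).exists_tendsto hC1 hγ (hinward.isBounded_image hγ)⟩
  · exact c.isSaddle_zero (hdiff 0) (Function.Odd.map_zero hφ.odd) hlt

theorem mainTheorem4 (c : OpAmp.Params) (φ : ℝ → ℝ) (hφ : OpAmp.IsSaturation φ)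
    (hfast : c.a < 1 / (c.R₀ * c.C₀)) :
    -- strict 1-passivity from `V_r` to `V₀`, with every rate in the interval
    (∀ lam ∈ Set.Ioo c.a (1 / (c.R₀ * c.C₀)), (c.closedLoop φ).IsStrictlyPassive 1 lam) ∧
    -- for every constant input, trajectories exist for all forward time, and each one converges
    -- to a fixed point
    (∀ Vr : ℝ,
      (∀ s₀ : Fin 2 → ℝ, ∃ γ : ℝ → (Fin 2 → ℝ), γ 0 = s₀ ∧
        OpAmp.IsTrajectory ((c.closedLoop φ).field ![Vr]) γ) ∧
      (∀ γ : ℝ → (Fin 2 → ℝ), OpAmp.IsTrajectory ((c.closedLoop φ).field ![Vr]) γ →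
        ∃ e : Fin 2 → ℝ, (c.closedLoop φ).field ![Vr] e = 0 ∧
          Filter.Tendsto γ Filter.atTop (nhds e))) ∧
    -- with `V_r = 0`, under the slope condition at the origin
    (deriv φ 0 < -(1 / c.R₀) + c.α * c.R₁ / (c.R₁ + c.Ra) →
      OpAmp.IsSaddle ((c.closedLoop φ).field ![0]) 0 ∧
      (∃ e : Fin 2 → ℝ, e ≠ 0 ∧ (c.closedLoop φ).field ![0] e = 0 ∧
        (c.closedLoop φ).field ![0] (-e) = 0) ∧
      (OpAmp.IsStiffening φ → OpAmp.IsBistable ((c.closedLoop φ).field ![0]))) :=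
  mainTheorem4_general c φ hφ
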